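/- Let $\Lambda_{\mathbb Q}$ be the ring of symmetric functions over $\mathbb Q$ in countably many variables $x_1,x_2,\dots$, let $h_n$ and $e_n$ be the complete homogeneous and the elementary symmetric functions, with $h_n=e_n=0$ for $n<0$, and for every integer $n$ put $$\hat h_n=h_n-h_{n-2},\qquad \hat e_n=e_n-e_{n-2},\qquad \check h_n=h_n+h_{n-2}+h_{n-4}+\cdots,\qquad \check e_n=e_n+e_{n-2}+e_{n-4}+\cdots .$$ For a partition $\lambda$ with parts $\lambda_1\ge\cdots\ge\lambda_l>0$ define the symplectic and orthogonal Schur functions by $$sp_\lambda=\tfrac12\det(h_{\lambda_i-i+j}+h_{\lambda_i-i-j+2})_{1\le i,j\le l},\qquad o_\lambda=\det(h_{\lambda_i-i+j}-h_{\lambda_i-i-j})_{1\le i,j\le l},$$ with $sp_\emptyset=o_\emptyset=1$ for the empty partition. Let $\lambda'$ be the conjugate partition of $\lambda$, and let $k,m\ge 1$ be integers such that $\lambda$ has at most $k$ parts and $\lambda'$ has at most $m$ parts; append zeros to write $\lambda=(\lambda_1,\dots,\lambda_k)$ and $\lambda'=(\lambda'_1,\dots,\lambda'_m)$. Then $$sp_\lambda=\tfrac12\det(h_{\lambda_i-i+j}+h_{\lambda_i-i-j+2})=\det(\check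 h_{\lambda_i-i+j}-\check h_{\lambda_i-i-j})=\det(e_{\lambda'_i-i+j}-e_{\lambda'_i-i-j})=\tfrac12\det(\hat e_{\lambda'_i-i+j}+\hat e_{\lambda'_i-i-j+2}),$$ $$o_\lambda=\det(h_{\lambda_i-i+j}-h_{\lambda_i-i-j})=\tfrac12\det(\hat h_{\lambda_i-i+j}+\hat h_{\lambda_i-i-j+2})=\tfrac12\det(e_{\lambda'_i-i+j}+e_{\lambda'_i-i-j+2})=\det(\check e_{\lambda'_i-i+j}-\check e_{\lambda'_i-i-j}),$$ where the determinants in $h,\hat h,\check h$ have size $k\times k$ and those in $e,\hat e,\check e$ have size $m\times m$. -/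

import Mathlib

/-! Symmetric functions in countably many variables over the rationals, and the universal
symplectic and orthogonal Schur functions. -/

namespace SymFun

/-- The `ℚ`-algebra of symmetric functions in the variables `x₀, x₁, x₂, …`: the formal power
series of bounded degree that are invariant under all permutations of the variables. -/
def Lam : Subalgebra ℚ (MvPowerSeries ℕ ℚ) where
  carrier := {f |
    (∃ N : ℕ, ∀ d : ℕ →₀ ℕ, N < d.degree → MvPowerSeries.coeff d f = 0) ∧
    ∀ (σ : Equiv.Perm ℕ) (d : ℕ →₀ ℕ),
      MvPowerSeries.coeff (d.equivMapDomain σ) f = MvPowerSeries.coeff d f}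
  mul_mem' := by
    rintro f g ⟨⟨M, hM⟩, hf⟩ ⟨⟨N, hN⟩, hg⟩
    refine ⟨⟨M + N, fun d hd => ?_⟩, fun σ d => ?_⟩
    · rw [MvPowerSeries.coeff_mul]
      refine Finset.sum_eq_zero fun p hp => ?_
      rw [Finset.HasAntidiagonal.mem_antidiagonal] at hp
      have h1 : p.1.degree + p.2.degree = d.degree := by rw [← hp, map_add]
      rcases lt_or_ge M p.1.degree with h | h
      · rw [hM _ h, zero_mul]
      · rw [hN _ (by omega), mul_zero]
    · rw [MvPowerSeries.coeff_mul, MvPowerSeries.coeff_mul]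
      symm
      refine Finset.sum_nbij'
        (fun p => (p.1.equivMapDomain σ, p.2.equivMapDomain σ))
        (fun p => (p.1.equivMapDomain σ.symm, p.2.equivMapDomain σ.symm)) ?_ ?_ ?_ ?_ ?_
      · intro p hp
        rw [Finset.HasAntidiagonal.mem_antidiagonal] at hp ⊢
        rw [← hp]
        ext i
        simp [Finsupp.equivMapDomain_apply]
      · intro p hp
        rw [Finset.HasAntidiagonal.mem_antidiagonal] at hp ⊢
        ext i
        have := DFunLike.congr_fun hp (σ i)
        simpa [Finsupp.equivMapDomain_apply] using this
      · intro p _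
        ext i <;> simp [Finsupp.equivMapDomain_apply]
      · intro p _
        ext i <;> simp [Finsupp.equivMapDomain_apply]
      · intro p _
        simp only [hf, hg]
  add_mem' := by
    rintro f g ⟨⟨M, hM⟩, hf⟩ ⟨⟨N, hN⟩, hg⟩
    refine ⟨⟨M + N, fun d hd => ?_⟩, fun σ d => ?_⟩
    · rw [map_add, hM d (by omega), hN d (by omega), add_zero]
    · rw [map_add, map_add, hf, hg]
  algebraMap_mem' := by
    intro r
    have key : ∀ d : ℕ →₀ ℕ, MvPowerSeries.coeff d (algebraMap ℚ (MvPowerSeries ℕ ℚ) r)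
        = if d = 0 then r else 0 := by
      intro d
      rw [MvPowerSeries.algebraMap_apply]
      simp [MvPowerSeries.coeff_C]
    refine ⟨⟨0, fun d hd => ?_⟩, fun σ d => ?_⟩
    · rw [key, if_neg]
      rintro rfl
      simp at hd
    · rw [key, key]
      have : d.equivMapDomain σ = 0 ↔ d = 0 := by
        constructor
        · intro h
          ext i
          have := DFunLike.congr_fun h (σ i)
          simpa [Finsupp.equivMapDomain_apply] using this
        · rintro rfl
          exact Finsupp.equivMapDomain_zero
      simp only [this]

theorem degree_equivMapDomain (σ : Equiv.Perm ℕ) (d : ℕ →₀ ℕ) :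
    (d.equivMapDomain σ).degree = d.degree := by
  rw [Finsupp.equivMapDomain_eq_mapDomain, Finsupp.degree_mapDomain]

/-- The formal sum of all monomials of degree `n`, as a power series in countably many variables;
it is `0` for `n < 0`. -/
noncomputable def hSeries (n : ℤ) : MvPowerSeries ℕ ℚ :=
  fun d : ℕ →₀ ℕ => if (d.degree : ℤ) = n then 1 else 0

theorem coeff_hSeries (n : ℤ) (d : ℕ →₀ ℕ) :
    MvPowerSeries.coeff d (hSeries n) = if (d.degree : ℤ) = n then 1 else 0 := rfl

open Classical in
/-- The formal sum of all squarefree monomials of degree `n`, as a power series in countably many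
variables; it is `0` for `n < 0`. -/
noncomputable def eSeries (n : ℤ) : MvPowerSeries ℕ ℚ :=
  fun d : ℕ →₀ ℕ => if (d.degree : ℤ) = n ∧ ∀ i, d i ≤ 1 then 1 else 0

open Classical in
theorem coeff_eSeries (n : ℤ) (d : ℕ →₀ ℕ) :
    MvPowerSeries.coeff d (eSeries n) =
      if (d.degree : ℤ) = n ∧ ∀ i, d i ≤ 1 then 1 else 0 := rfl

/-- The complete homogeneous symmetric function `h_n`, with `h_n = 0` for `n < 0`. -/
noncomputable def h (n : ℤ) : Lam :=
  ⟨hSeries n, by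
    refine ⟨⟨n.toNat, fun d hd => ?_⟩, fun σ d => ?_⟩
    · rw [coeff_hSeries, if_neg (by omega)]
    · rw [coeff_hSeries, coeff_hSeries, degree_equivMapDomain]⟩

/-- The elementary symmetric function `e_n`, with `e_n = 0` for `n < 0`. -/
noncomputable def e (n : ℤ) : Lam :=
  ⟨eSeries n, by
    refine ⟨⟨n.toNat, fun d hd => ?_⟩, fun σ d => ?_⟩
    · rw [coeff_eSeries, if_neg (by omega)]
    · classical
      have : (∀ i, d.equivMapDomain σ i ≤ 1) ↔ ∀ i, d i ≤ 1 := by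
        simp only [Finsupp.equivMapDomain_apply]
        exact σ.symm.forall_congr_right (q := fun i => d i ≤ 1)
      rw [coeff_eSeries, coeff_eSeries]
      exact if_congr (and_congr (by rw [degree_equivMapDomain]) this) rfl rfl⟩

/-- `ĥ_n = h_n - h_{n-2}` for `f = h`, and `ê_n = e_n - e_{n-2}` for `f = e`. -/
noncomputable def hat (f : ℤ → Lam) (n : ℤ) : Lam := f n - f (n - 2)

/-- `ȟ_n = h_n + h_{n-2} + h_{n-4} + ⋯` for `f = h`, and likewise `ě_n` for `f = e`. The terms
with a negative index vanish, so the sum may be cut off at `n - 2 * r` with `r = n`. -/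
noncomputable def check (f : ℤ → Lam) (n : ℤ) : Lam :=
  ∑ r ∈ Finset.range (n.toNat + 1), f (n - 2 * (r : ℤ))

/-- The determinant `det (f_{a_i - i + j} + f_{a_i - i - j + 2})`, `1 ≤ i, j ≤ k`, of a sequence
`a_1, a_2, …`; the term `a_i` is `a (i - 1)` in Lean. -/
noncomputable def detPlus (f : ℤ → Lam) (a : ℕ → ℕ) (k : ℕ) : Lam :=
  Matrix.det (Matrix.of fun r s : Fin k =>
    let i : ℤ := (r : ℕ) + 1
    let j : ℤ := (s : ℕ) + 1
    f ((a r : ℤ) - i + j) + f ((a r : ℤ) - i - j + 2))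

/-- The determinant `det (f_{a_i - i + j} - f_{a_i - i - j})`, `1 ≤ i, j ≤ k`, of a sequence
`a_1, a_2, …`; the term `a_i` is `a (i - 1)` in Lean. -/
noncomputable def detMinus (f : ℤ → Lam) (a : ℕ → ℕ) (k : ℕ) : Lam :=
  Matrix.det (Matrix.of fun r s : Fin k =>
    let i : ℤ := (r : ℕ) + 1
    let j : ℤ := (s : ℕ) + 1
    f ((a r : ℤ) - i + j) - f ((a r : ℤ) - i - j))

/-- The universal symplectic Schur function of a partition with parts `μ_1, …, μ_k`. Here `k` is
the number of rows of `μ`; the empty partition is written `(0)`, so that it is given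
the value `1`. -/
noncomputable def sp (μ : YoungDiagram) : Lam :=
  (1 / 2 : ℚ) • detPlus h μ.rowLen (max 1 (μ.colLen 0))

/-- The universal orthogonal Schur function of a partition with parts `μ_1, …, μ_k`, where `k` is
the number of rows of `μ`. -/
noncomputable def o (μ : YoungDiagram) : Lam :=
  detMinus h μ.rowLen (μ.colLen 0)

end SymFun

/-! Two mechanisms give all the identities. First, a matrix with entries `f (n + j) - f (n - j)`
becomes, after subtracting column `j - 2` from column `j`, the plus matrix of `f n - f (n - 2)`.
Formally, column `0` vanishes and column `-1` is minus column `1`, so the first column doubles; this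
is the source of the factor `1/2` (`det_plusMatrix_sub`). Since hat undoes check, both the hat and
the check identities follow.

Second, `h` and `e` have inverse generating functions up to sign. Hence a `(k + m) × k` matrix `X`
of folded shifts of `f` is nearly annihilated by the transpose of a unitriangular matrix `U` built
from `g`: only the `D` block, of determinant `2`, survives. Jacobi's complementary minor theorem
(`det_complementary_minor`) equates, up to sign, the minor of `X` in the rows `μ_i + k - i` with
twice the minor of `U` in the complementary rows `k + j - 1 - μ'_j` (`i`, `j` from `1`). These are
the plus determinant of `μ` and the minus determinant of `μ'` (`det_plusMatrix_rowLen`). The sign is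
that of a Grassmannian permutation (`sign_grassmannPerm`). -/

namespace SymFun

/-! ### Complementary minors and column operations. -/

section Determinants

variable {R : Type*} [CommRing R]

open Matrix in
/-- A form of Jacobi's complementary minor formula. -/
theorem det_complementary_minor {ι κ n : Type*} [Fintype ι] [DecidableEq ι] [Fintype κ]
    [DecidableEq κ] [Fintype n] [DecidableEq n] (t : ι ⊕ κ ≃ n) (σ : Equiv.Perm n)
    (U : Matrix n n R) (X : Matrix n ι R) (D : Matrix ι ι R)
    (hD : ∀ i i', ∑ p, U p (t (Sum.inl i)) * X p i' = D i i')
    (h0 : ∀ j i', ∑ p, U p (t (Sum.inr j)) * X p i' = 0) :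
    (Equiv.Perm.sign σ : R) * U.det * (X.submatrix (fun i => σ (t (Sum.inl i))) id).det =
      D.det * (U.submatrix (fun j => σ (t (Sum.inr j))) (fun j => t (Sum.inr j))).det := by
  -- Completing `X` to a square matrix by identity columns makes both the second factor and the
  -- product block triangular, so every determinant splits.
  have key : (Uᵀ.submatrix t (fun a => σ (t a))) *
      fromBlocks (X.submatrix (fun i => σ (t (Sum.inl i))) id) 0
        (X.submatrix (fun j => σ (t (Sum.inr j))) id) 1 =
      fromBlocks D (Uᵀ.submatrix (fun i => t (Sum.inl i)) (fun j => σ (t (Sum.inr j)))) 0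
        (Uᵀ.submatrix (fun j => t (Sum.inr j)) (fun j => σ (t (Sum.inr j)))) := by
    have hsum : ∀ (q : n) (i' : ι), (∑ i : ι, U (σ (t (Sum.inl i))) q * X (σ (t (Sum.inl i))) i') +
        ∑ j : κ, U (σ (t (Sum.inr j))) q * X (σ (t (Sum.inr j))) i' = ∑ p, U p q * X p i' := by
      intro q i'
      rw [← Fintype.sum_sum_type (fun a => U (σ (t a)) q * X (σ (t a)) i')]
      exact Equiv.sum_comp (t.trans σ) (fun p => U p q * X p i')
    ext a b
    rcases a with a | a <;> rcases b with b | b <;>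
      simp [Matrix.mul_apply, Fintype.sum_sum_type, hsum, hD, h0, Matrix.one_apply]
  have hdet := congrArg Matrix.det key
  rw [det_mul, det_fromBlocks_zero₁₂, det_fromBlocks_zero₂₁, det_one, mul_one] at hdet
  have h1 : (Uᵀ.submatrix t (fun a => σ (t a))).det = (Equiv.Perm.sign σ : R) * U.det := by
    have : Uᵀ.submatrix t (fun a => σ (t a)) = (Uᵀ.submatrix id σ).submatrix t t := rfl
    rw [this, det_submatrix_equiv_self, det_permute', det_transpose]
  rw [h1] at hdet
  rw [hdet, ← det_transpose (U.submatrix _ _)]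
  rfl

/-- The matrix of `detPlus`, over any commutative ring. -/
def plusMatrix (f : ℤ → R) (a : ℕ → ℕ) (k : ℕ) : Matrix (Fin k) (Fin k) R :=
  Matrix.of fun r s =>
    f ((a r : ℤ) - ((r : ℕ) + 1) + ((s : ℕ) + 1)) +
      f ((a r : ℤ) - ((r : ℕ) + 1) - ((s : ℕ) + 1) + 2)

/-- The matrix of `detMinus`, over any commutative ring. -/
def minusMatrix (f : ℤ → R) (a : ℕ → ℕ) (k : ℕ) : Matrix (Fin k) (Fin k) R :=
  Matrix.of fun r s =>
    f ((a r : ℤ) - ((r : ℕ) + 1) + ((s : ℕ) + 1)) -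
      f ((a r : ℤ) - ((r : ℕ) + 1) - ((s : ℕ) + 1))

/-- Column operations turn the `minusMatrix` of `f` into the `plusMatrix` of `f n - f (n - 2)`. -/
theorem det_plusMatrix_sub (f : ℤ → R) (a : ℕ → ℕ) {k : ℕ} (hk : 1 ≤ k) :
    (plusMatrix (fun n => f n - f (n - 2)) a k).det = 2 * (minusMatrix f a k).det := by
  obtain ⟨k, rfl⟩ : ∃ l, k = l + 1 := ⟨k - 1, by omega⟩
  -- The column operation: subtract the column two to the left, and double the first column.
  set T : Matrix (Fin (k + 1)) (Fin (k + 1)) R := Matrix.of fun s s' =>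
    (if s = s' then (if s = 0 then 2 else 1) else 0) -
      (if (s : ℕ) + 2 = s' then 1 else 0) with hT
  have hTdet : T.det = 2 := by
    rw [Matrix.det_of_isUpperTriangular, Fin.prod_univ_succ]
    · simp [hT, Fin.succ_ne_zero]
    · intro s s' hs
      simp only [id] at hs
      have h1 : s ≠ s' := hs.ne'
      have h2 : ¬ (s : ℕ) + 2 = s' := by have := Fin.lt_def.1 hs; omega
      simp [hT, h1, h2]
  have key : plusMatrix (fun n => f n - f (n - 2)) a (k + 1) = minusMatrix f a (k + 1) * T := by
    ext r s'
    simp only [Matrix.mul_apply, hT, Matrix.of_apply, mul_sub, Finset.sum_sub_distrib, mul_ite,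
      mul_zero, mul_one, Finset.sum_ite_eq', Finset.mem_univ, if_true]
    generalize hn : (a r : ℤ) - ((r : ℕ) + 1) = n
    by_cases h2 : 2 ≤ (s' : ℕ)
    · have hs0 : s' ≠ 0 := by rintro rfl; simp at h2
      rw [if_neg hs0, Finset.sum_eq_single (⟨s' - 2, by omega⟩ : Fin (k + 1))]
      · simp only [plusMatrix, minusMatrix, Matrix.of_apply, hn]
        have : (((s' : ℕ) - 2 : ℕ) : ℤ) = (s' : ℕ) - 2 := by omega
        rw [if_pos (by omega), this]
        ring_nf
      · intro b _ hb
        rw [if_neg]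
        intro h
        exact hb (Fin.ext (by simp; omega))
      · simp
    · rw [Finset.sum_eq_zero (fun b _ => if_neg (by omega)), sub_zero]
      simp only [plusMatrix, minusMatrix, Matrix.of_apply, hn]
      by_cases hs0 : s' = 0
      · subst hs0
        simp
        ring_nf
      · have h1 : (s' : ℕ) = 1 := by
          have : (s' : ℕ) ≠ 0 := fun h => hs0 (Fin.ext h)
          omega
        rw [if_neg hs0, h1]
        push_cast
        ring_nf
  rw [key, Matrix.det_mul, hTdet, mul_comm]

end Determinants

end SymFun

namespace SymFun

/-! ### The Grassmannian permutation of a partition and its sign. -/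

section Permutation

theorem colLen_le_iff (μ : YoungDiagram) (i j : ℕ) : μ.colLen j ≤ i ↔ μ.rowLen i ≤ j := by
  rw [← not_lt, ← not_lt, ← YoungDiagram.mem_iff_lt_colLen, ← YoungDiagram.mem_iff_lt_rowLen]

theorem colLen_le (μ : YoungDiagram) {k : ℕ} (hk : μ.colLen 0 ≤ k) (j : ℕ) : μ.colLen j ≤ k :=
  (μ.colLen_anti 0 j (Nat.zero_le j)).trans hk

theorem rowLen_le (μ : YoungDiagram) {m : ℕ} (hm : μ.rowLen 0 ≤ m) (i : ℕ) : μ.rowLen i ≤ m :=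
  (μ.rowLen_anti 0 i (Nat.zero_le i)).trans hm

/-- The Grassmannian permutation of a partition in a `k × m` box, as a function. -/
def grassmannFun (μ : YoungDiagram) {k m : ℕ} (hk : μ.colLen 0 ≤ k) (hm : μ.rowLen 0 ≤ m) :
    Fin (k + m) → Fin (k + m) :=
  Fin.addCases
    (fun r => ⟨μ.rowLen (r.rev : Fin k) + r, by have := rowLen_le μ hm (r.rev : Fin k); omega⟩)
    (fun j => ⟨k + j - μ.colLen j, by omega⟩)

theorem grassmannFun_castAdd (μ : YoungDiagram) {k m : ℕ} (hk : μ.colLen 0 ≤ k) (hm : μ.rowLen 0 ≤ m)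
    (r : Fin k) :
    (grassmannFun μ hk hm (Fin.castAdd m r) : ℕ) = μ.rowLen (r.rev : Fin k) + r := by
  simp [grassmannFun]

theorem grassmannFun_natAdd (μ : YoungDiagram) {k m : ℕ} (hk : μ.colLen 0 ≤ k) (hm : μ.rowLen 0 ≤ m)
    (j : Fin m) :
    (grassmannFun μ hk hm (Fin.natAdd k j) : ℕ) = k + j - μ.colLen j := by
  simp [grassmannFun]

theorem grassmannFun_castAdd_lt (μ : YoungDiagram) {k m : ℕ} (hk : μ.colLen 0 ≤ k) (hm : μ.rowLen 0 ≤ m)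
    {r s : Fin k} (hrs : r < s) :
    grassmannFun μ hk hm (Fin.castAdd m r) < grassmannFun μ hk hm (Fin.castAdd m s) := by
  rw [Fin.lt_def, grassmannFun_castAdd, grassmannFun_castAdd]
  have h1 : ((s.rev : Fin k) : ℕ) ≤ (r.rev : Fin k) := Fin.rev_le_rev.2 hrs.le
  have := μ.rowLen_anti _ _ h1
  have := Fin.lt_def.1 hrs
  omega

theorem grassmannFun_natAdd_lt (μ : YoungDiagram) {k m : ℕ} (hk : μ.colLen 0 ≤ k) (hm : μ.rowLen 0 ≤ m)
    {i j : Fin m} (hij : i < j) :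
    grassmannFun μ hk hm (Fin.natAdd k i) < grassmannFun μ hk hm (Fin.natAdd k j) := by
  rw [Fin.lt_def, grassmannFun_natAdd, grassmannFun_natAdd]
  have := μ.colLen_anti i j (Fin.lt_def.1 hij).le
  have := Fin.lt_def.1 hij
  have := colLen_le μ hk i
  omega

/-- The condition says that the box in row `r.rev`, column `j` belongs to `μ`. The strictness gives
injectivity, and the direction gives the inversions. -/
theorem grassmannFun_cross (μ : YoungDiagram) {k m : ℕ} (hk : μ.colLen 0 ≤ k) (hm : μ.rowLen 0 ≤ m)
    (r : Fin k) (j : Fin m) :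
    if (r.rev : ℕ) < μ.colLen j then
      grassmannFun μ hk hm (Fin.natAdd k j) < grassmannFun μ hk hm (Fin.castAdd m r)
    else grassmannFun μ hk hm (Fin.castAdd m r) < grassmannFun μ hk hm (Fin.natAdd k j) := by
  rw [Fin.lt_def, Fin.lt_def, grassmannFun_natAdd, grassmannFun_castAdd]
  have h1 := colLen_le_iff μ (r.rev : Fin k) j
  have h2 := colLen_le μ hk j
  have h3 : ((r.rev : Fin k) : ℕ) = k - (r + 1) := Fin.val_rev r
  have h4 := r.isLt
  split_ifs <;> omega

theorem grassmannFun_injective (μ : YoungDiagram) {k m : ℕ} (hk : μ.colLen 0 ≤ k) (hm : μ.rowLen 0 ≤ m)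
    : Function.Injective (grassmannFun μ hk hm) := by
  intro a b hab
  induction a using Fin.addCases with
  | left r =>
    induction b using Fin.addCases with
    | left s =>
      rcases lt_trichotomy r s with h | h | h
      · exact absurd hab (grassmannFun_castAdd_lt μ hk hm h).ne
      · rw [h]
      · exact absurd hab (grassmannFun_castAdd_lt μ hk hm h).ne'
    | right j =>
      have := grassmannFun_cross μ hk hm r j
      split_ifs at this
      · exact absurd hab this.ne'
      · exact absurd hab this.ne
  | right i =>
    induction b using Fin.addCases with
    | left r =>
      have := grassmannFun_cross μ hk hm r i
      split_ifs at this
      · exact absurd hab this.ne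
      · exact absurd hab this.ne'
    | right j =>
      rcases lt_trichotomy i j with h | h | h
      · exact absurd hab (grassmannFun_natAdd_lt μ hk hm h).ne
      · rw [h]
      · exact absurd hab (grassmannFun_natAdd_lt μ hk hm h).ne'

/-- The Grassmannian permutation of a partition in a `k × m` box. -/
noncomputable def grassmannPerm (μ : YoungDiagram) {k m : ℕ} (hk : μ.colLen 0 ≤ k) (hm : μ.rowLen 0 ≤ m) :
    Equiv.Perm (Fin (k + m)) :=
  Equiv.ofBijective _ (Finite.injective_iff_bijective.1 (grassmannFun_injective μ hk hm))

theorem grassmannPerm_castAdd (μ : YoungDiagram) {k m : ℕ} (hk : μ.colLen 0 ≤ k) (hm : μ.rowLen 0 ≤ m)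
    (r : Fin k) :
    (grassmannPerm μ hk hm (Fin.castAdd m r) : ℕ) = μ.rowLen (r.rev : Fin k) + r :=
  grassmannFun_castAdd μ hk hm r

theorem grassmannPerm_natAdd (μ : YoungDiagram) {k m : ℕ} (hk : μ.colLen 0 ≤ k) (hm : μ.rowLen 0 ≤ m)
    (j : Fin m) :
    (grassmannPerm μ hk hm (Fin.natAdd k j) : ℕ) = k + j - μ.colLen j :=
  grassmannFun_natAdd μ hk hm j

/-- The permutation increases on each of its two blocks, so its inversions are mixed pairs, one for
each box of `μ`; the product counts them by columns. -/
theorem sign_grassmannPerm (μ : YoungDiagram) {k m : ℕ} (hk : μ.colLen 0 ≤ k) (hm : μ.rowLen 0 ≤ m)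
    :
    Equiv.Perm.sign (grassmannPerm μ hk hm) = ∏ j : Fin m, (-1) ^ μ.colLen j := by
  have hIoi : ∀ i : Fin (k + m), ∀ F : Fin (k + m) → ℤˣ,
      ∏ j ∈ Finset.Ioi i, F j = ∏ j, if i < j then F j else 1 := by
    intro i F
    rw [← Finset.prod_filter]
    congr 1
    ext; simp
  rw [Equiv.Perm.sign_eq_prod_prod_Ioi]
  simp only [hIoi]
  rw [Fin.prod_univ_add]
  simp only [Fin.prod_univ_add]
  have h1 : ∀ r s : Fin k, (if Fin.castAdd m r < Fin.castAdd m s then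
      if grassmannPerm μ hk hm (Fin.castAdd m r) < grassmannPerm μ hk hm (Fin.castAdd m s)
      then (1 : ℤˣ) else -1 else 1) = 1 := by
    intro r s
    split_ifs with h2 h3
    · rfl
    · exact absurd (grassmannFun_castAdd_lt μ hk hm h2) h3
    · rfl
  have h2 : ∀ i j : Fin m, (if Fin.natAdd k i < Fin.natAdd k j then
      if grassmannPerm μ hk hm (Fin.natAdd k i) < grassmannPerm μ hk hm (Fin.natAdd k j)
      then (1 : ℤˣ) else -1 else 1) = 1 := by
    intro i j
    split_ifs with h2 h3
    · rfl
    · exact absurd (grassmannFun_natAdd_lt μ hk hm (by simpa using h2)) h3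
    · rfl
  have h3 : ∀ (i : Fin m) (r : Fin k), (if Fin.natAdd k i < Fin.castAdd m r then
      if grassmannPerm μ hk hm (Fin.natAdd k i) < grassmannPerm μ hk hm (Fin.castAdd m r)
      then (1 : ℤˣ) else -1 else 1) = 1 := by
    intro i r
    rw [if_neg]
    rw [Fin.lt_def]
    simp
    omega
  have h4 : ∀ (r : Fin k) (i : Fin m), (if Fin.castAdd m r < Fin.natAdd k i then
      if grassmannPerm μ hk hm (Fin.castAdd m r) < grassmannPerm μ hk hm (Fin.natAdd k i)
      then (1 : ℤˣ) else -1 else 1) = if (r.rev : ℕ) < μ.colLen i then -1 else 1 := by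
    intro r i
    rw [if_pos (show Fin.castAdd m r < Fin.natAdd k i by rw [Fin.lt_def]; simp; omega)]
    have := grassmannFun_cross μ hk hm r i
    by_cases h : (r.rev : ℕ) < μ.colLen i
    · rw [if_pos h] at this ⊢
      exact if_neg this.le.not_gt
    · rw [if_neg h] at this ⊢
      exact if_pos this
  simp only [h1, h2, h3, h4, Finset.prod_const_one, one_mul, mul_one]
  rw [Finset.prod_comm]
  refine Finset.prod_congr rfl fun j _ => ?_
  have h5 := Equiv.prod_comp Fin.revPerm (fun r : Fin k => if (r : ℕ) < μ.colLen j then (-1 : ℤˣ) else 1)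
  simp only [Fin.revPerm_apply] at h5
  rw [h5, Finset.prod_ite, Finset.prod_const, Finset.prod_const_one, mul_one, Fin.card_filter_val_lt,
    min_eq_right (colLen_le μ hk j)]

end Permutation

end SymFun

namespace SymFun

/-! ### Duality between plus and minus determinants. -/

section Duality

variable {R : Type*} [CommRing R]

/-- A shifted coefficient of `F(-t) G(t) = 1`. The bound `b < N` ensures that truncating at `N`
loses no nonzero term. -/
theorem sum_neg_one_pow_mul_shift {f g : ℤ → R} (hf : ∀ n < 0, f n = 0) (hg : ∀ n < 0, g n = 0)
    (hf0 : f 0 = 1) (hg0 : g 0 = 1)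
    (hfg : ∀ n : ℕ, n ≠ 0 → ∑ i ∈ Finset.range (n + 1), (-1) ^ i * (f i * g (n - i)) = 0)
    {N : ℕ} (a : ℕ) (b : ℤ) (hb : b < N) :
    ∑ p : Fin N, (-1) ^ (p : ℕ) * (f ((p : ℕ) - a) * g (b - (p : ℕ))) =
      if b = a then (-1) ^ a else 0 := by
  rw [Fin.sum_univ_eq_sum_range (fun p : ℕ => (-1) ^ p * (f (p - a) * g (b - p)))]
  rcases lt_or_ge b a with hba | hba
  · rw [if_neg hba.ne]
    refine Finset.sum_eq_zero fun p _ => ?_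
    rcases lt_or_ge (p : ℤ) a with h | h
    · rw [hf _ (by omega)]; ring
    · rw [hg _ (by omega)]; ring
  · obtain ⟨n, rfl⟩ : ∃ n : ℕ, b = a + n := ⟨(b - a).toNat, by omega⟩
    have hsub : Finset.Ico a (a + (n + 1)) ⊆ Finset.range N := by
      intro p; simp; omega
    rw [← Finset.sum_subset hsub, Finset.sum_Ico_eq_sum_range]
    · have hterm : ∀ i : ℕ, (-1 : R) ^ (a + i) * (f ((a + i : ℕ) - a) * g (a + n - (a + i : ℕ))) =
          (-1) ^ a * ((-1) ^ i * (f i * g (n - i))) := by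
        intro i
        rw [pow_add]
        push_cast
        rw [add_sub_cancel_left, add_sub_add_left_eq_sub]
        ring
      simp only [hterm, ← Finset.mul_sum, add_tsub_cancel_left]
      by_cases hn : n = 0
      · subst hn
        simp [hf0, hg0]
      · rw [hfg n hn, if_neg (by omega), mul_zero]
    · intro p _ hp
      have : (p : ℤ) < a ∨ (a : ℤ) + n < p := by
        simp only [Finset.mem_Ico] at hp; omega
      rcases this with h | h
      · rw [hf _ (by omega)]; ring
      · rw [hg _ (by omega)]; ring

/-- Duality between the symplectic and orthogonal Jacobi–Trudi determinants of two sequences whose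
generating functions are inverse to each other up to sign. -/
theorem det_plusMatrix_rowLen {f g : ℤ → R} (hf : ∀ n < 0, f n = 0) (hg : ∀ n < 0, g n = 0)
    (hf0 : f 0 = 1) (hg0 : g 0 = 1)
    (hfg : ∀ n : ℕ, n ≠ 0 → ∑ i ∈ Finset.range (n + 1), (-1) ^ i * (f i * g (n - i)) = 0)
    (μ : YoungDiagram) {k m : ℕ} (hk1 : 1 ≤ k) (hk : μ.colLen 0 ≤ k) (hm : μ.rowLen 0 ≤ m) :
    (plusMatrix f μ.rowLen k).det = 2 * (minusMatrix g μ.colLen m).det := by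
  have conv := fun (a : ℕ) (b : ℤ) (hb : b < (k + m : ℕ)) =>
    sum_neg_one_pow_mul_shift hf hg hf0 hg0 hfg a b hb
  -- The first block is reversed so that the selected rows of `X` appear in the order of the parts
  -- of `μ`; `t` enters both sides of the minor formula, so this costs no sign.
  set t : Fin k ⊕ Fin m ≃ Fin (k + m) :=
    (Equiv.sumCongr Fin.revPerm (Equiv.refl _)).trans finSumFinEquiv with ht
  have htl : ∀ i, t (Sum.inl i) = Fin.castAdd m i.rev := fun i => by simp [ht]
  have htr : ∀ j, t (Sum.inr j) = Fin.natAdd k j := fun j => by simp [ht]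
  -- Column `q` pairs with the shifts of `f` by convolution. For `q ≥ k` the index is also reflected
  -- about `k - 1`, to `2k - 2 - q`, matching the folding of `X`.
  set U : Matrix (Fin (k + m)) (Fin (k + m)) R := Matrix.of fun p q =>
    (-1) ^ (p : ℕ) * (-1) ^ (q : ℕ) * (g ((q : ℕ) - (p : ℕ)) -
      if (q : ℕ) < k then 0 else g (2 * k - 2 - (q : ℕ) - (p : ℕ))) with hU
  set X : Matrix (Fin (k + m)) (Fin k) R := Matrix.of fun p s =>
    f ((p : ℕ) - (k - 1 - (s : ℕ) : ℕ)) + f ((p : ℕ) - (k - 1 + (s : ℕ) : ℕ)) with hX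
  set D : Matrix (Fin k) (Fin k) R :=
    Matrix.diagonal fun s => if (s : ℕ) = 0 then 2 else 1 with hDdef
  have hUdet : U.det = 1 := by
    rw [Matrix.det_of_isUpperTriangular]
    · refine Finset.prod_eq_one fun q _ => ?_
      have h1 : (if (q : ℕ) < k then 0 else g (2 * k - 2 - (q : ℕ) - (q : ℕ))) = 0 := by
        split_ifs
        · rfl
        · exact hg _ (by omega)
      simp only [hU, Matrix.of_apply, h1, sub_self, hg0, sub_zero, mul_one]
      rw [← mul_pow]; simp
    · intro p q hpq
      have hpq' : (q : ℕ) < (p : ℕ) := hpq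
      have h1 : (if (q : ℕ) < k then 0 else g (2 * k - 2 - (q : ℕ) - (p : ℕ))) = 0 := by
        split_ifs
        · rfl
        · exact hg _ (by omega)
      simp only [hU, Matrix.of_apply, h1, hg _ (show ((q : ℕ) : ℤ) - (p : ℕ) < 0 by omega),
        sub_zero, mul_zero]
  have hDdet : D.det = 2 := by
    obtain ⟨k, rfl⟩ : ∃ l, k = l + 1 := ⟨k - 1, by omega⟩
    rw [hDdef, Matrix.det_diagonal, Fin.prod_univ_succ]
    simp
  have hsq : ∀ n : ℕ, (-1 : R) ^ n * (-1) ^ n = 1 := fun n => by rw [← mul_pow]; simp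
  have hD : ∀ i i', ∑ p, U p (t (Sum.inl i)) * X p i' = D i i' := by
    intro i i'
    have hi := i.isLt
    have hi' := i'.isLt
    have hq : ((t (Sum.inl i) : Fin (k + m)) : ℕ) = k - 1 - i := by
      rw [htl, Fin.val_castAdd, Fin.val_rev]; omega
    have hterm : ∀ p : Fin (k + m), U p (t (Sum.inl i)) * X p i' = (-1) ^ (k - 1 - i : ℕ) *
        ((-1) ^ (p : ℕ) * (f ((p : ℕ) - (k - 1 - i' : ℕ)) * g ((k - 1 - i : ℕ) - (p : ℕ))) +
        (-1) ^ (p : ℕ) * (f ((p : ℕ) - (k - 1 + i' : ℕ)) * g ((k - 1 - i : ℕ) - (p : ℕ)))) := by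
      intro p
      simp only [hU, hX, Matrix.of_apply, hq]
      rw [if_pos (by omega)]
      ring
    simp only [hterm]
    rw [← Finset.mul_sum, Finset.sum_add_distrib, conv _ _ (by omega), conv _ _ (by omega)]
    by_cases hii : i = i'
    · subst hii
      rw [if_pos rfl, hDdef, Matrix.diagonal_apply_eq]
      by_cases h0 : (i : ℕ) = 0
      · rw [if_pos h0, h0]
        simp only [Nat.sub_zero, Nat.add_zero, if_true, mul_add, hsq]
        norm_num
      · rw [if_neg h0, if_neg (by omega), add_zero, hsq]
    · have hne : (i : ℕ) ≠ i' := fun h => hii (Fin.ext h)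
      rw [hDdef, Matrix.diagonal_apply_ne _ hii, if_neg (by omega), if_neg (by omega)]
      ring
  have h0 : ∀ j i', ∑ p, U p (t (Sum.inr j)) * X p i' = 0 := by
    intro j i'
    have hj := j.isLt
    have hi' := i'.isLt
    have hq : ((t (Sum.inr j) : Fin (k + m)) : ℕ) = k + j := by
      rw [htr, Fin.val_natAdd]
    have hterm : ∀ p : Fin (k + m), U p (t (Sum.inr j)) * X p i' = (-1) ^ (k + j : ℕ) *
        ((-1) ^ (p : ℕ) * (f ((p : ℕ) - (k - 1 - i' : ℕ)) * g ((k + j : ℕ) - (p : ℕ))) +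
        (-1) ^ (p : ℕ) * (f ((p : ℕ) - (k - 1 + i' : ℕ)) * g ((k + j : ℕ) - (p : ℕ))) -
        (-1) ^ (p : ℕ) * (f ((p : ℕ) - (k - 1 - i' : ℕ)) *
          g (2 * k - 2 - (k + j : ℕ) - (p : ℕ))) -
        (-1) ^ (p : ℕ) * (f ((p : ℕ) - (k - 1 + i' : ℕ)) *
          g (2 * k - 2 - (k + j : ℕ) - (p : ℕ)))) := by
      intro p
      simp only [hU, hX, Matrix.of_apply, hq]
      rw [if_neg (by omega)]
      ring
    simp only [hterm]
    rw [← Finset.mul_sum, Finset.sum_sub_distrib, Finset.sum_sub_distrib, Finset.sum_add_distrib,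
      conv _ _ (by omega), conv _ _ (by omega), conv _ _ (by omega), conv _ _ (by omega),
      if_neg (by omega), if_neg (show ¬ (2 * (k : ℤ) - 2 - (k + j : ℕ) = (k - 1 + i' : ℕ)) by omega)]
    -- Only here do any convolutions survive: `k + j` meets the shift `k - 1 + i'`, its reflection
    -- meets `k - 1 - i'`, and the two cancel because the shifts have equal parity.
    by_cases hij : (i' : ℕ) = j + 1
    · rw [if_pos (by omega), if_pos (by omega)]
      have : k - 1 + (i' : ℕ) = (k - 1 - i') + 2 * i' := by omega
      rw [this, pow_add _ (k - 1 - (i' : ℕ)), pow_mul]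
      simp
    · rw [if_neg (by omega), if_neg (by omega)]
      simp
  have key := det_complementary_minor t (grassmannPerm μ hk hm) U X D hD h0
  have hXI : X.submatrix (fun i => grassmannPerm μ hk hm (t (Sum.inl i))) id =
      plusMatrix f μ.rowLen k := by
    ext i s
    have hi := i.isLt
    have hs := s.isLt
    simp only [hX, plusMatrix, Matrix.submatrix_apply, Matrix.of_apply, htl, grassmannPerm_castAdd,
      Fin.rev_rev, Fin.val_rev, id]
    congr 2 <;> omega
  have hUJ : U.submatrix (fun j => grassmannPerm μ hk hm (t (Sum.inr j))) (fun j => t (Sum.inr j)) =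
      Matrix.of fun i j : Fin m => (-1) ^ (k + i + μ.colLen i) *
        (Matrix.of fun i j : Fin m => (-1) ^ (k + j : ℕ) * minusMatrix g μ.colLen m i j) i j := by
    ext i j
    have hc := colLen_le μ hk i
    simp only [hU, minusMatrix, Matrix.submatrix_apply, Matrix.of_apply, htr, grassmannPerm_natAdd,
      Fin.val_natAdd]
    rw [if_neg (by omega), mul_assoc]
    congr 1
    · have : k + (i : ℕ) + μ.colLen i = (k + i - μ.colLen i) + 2 * μ.colLen i := by omega
      rw [this, pow_add, pow_mul]
      simp
    · congr 3 <;> omega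
  have hsign : ((Equiv.Perm.sign (grassmannPerm μ hk hm) : ℤˣ) : R) =
      ∏ j : Fin m, (-1) ^ μ.colLen j := by
    rw [sign_grassmannPerm]
    push_cast
    rfl
  rw [hXI, hUJ, Matrix.det_mul_column, Matrix.det_mul_row, hUdet, hDdet, hsign, mul_one,
    ← mul_assoc (∏ i, _) (∏ i, _), ← Finset.prod_mul_distrib] at key
  have hprod : ∀ i : Fin m, (-1 : R) ^ (k + i + μ.colLen i) * (-1) ^ (k + i : ℕ) =
      (-1) ^ μ.colLen i := by
    intro i
    rw [pow_add _ (k + (i : ℕ)), mul_right_comm, hsq, one_mul]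
  simp only [hprod] at key
  -- The sign of the permutation equals the total sign extracted from the rows and columns of `U`,
  -- so it can be cancelled over any commutative ring.
  have hS : (∏ j : Fin m, (-1 : R) ^ μ.colLen j) * ∏ j : Fin m, (-1 : R) ^ μ.colLen j = 1 := by
    rw [← Finset.prod_mul_distrib]
    exact Finset.prod_eq_one fun j _ => hsq _
  linear_combination (∏ j : Fin m, (-1 : R) ^ μ.colLen j) * key +
    (2 * (minusMatrix g μ.colLen m).det - (plusMatrix f μ.rowLen k).det) * hS

end Duality

end SymFun

namespace SymFun

/-! ### Generating function relations and the specialization to `h` and `e`. -/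

section SymmetricFunctions

theorem h_of_neg (n : ℤ) (hn : n < 0) : h n = 0 := by
  apply Subtype.ext
  ext d
  change MvPowerSeries.coeff d (hSeries n) = 0
  rw [coeff_hSeries, if_neg (by omega)]

theorem e_of_neg (n : ℤ) (hn : n < 0) : e n = 0 := by
  apply Subtype.ext
  ext d
  change MvPowerSeries.coeff d (eSeries n) = 0
  rw [coeff_eSeries, if_neg (by omega)]

theorem h_zero : h 0 = 1 := by
  apply Subtype.ext
  ext d
  change MvPowerSeries.coeff d (hSeries 0) = MvPowerSeries.coeff d 1
  classical
  rw [coeff_hSeries, MvPowerSeries.coeff_one]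
  exact if_congr (by simp [Finsupp.degree_eq_zero_iff]) rfl rfl

theorem e_zero : e 0 = 1 := by
  apply Subtype.ext
  ext d
  change MvPowerSeries.coeff d (eSeries 0) = MvPowerSeries.coeff d 1
  classical
  rw [coeff_eSeries, MvPowerSeries.coeff_one]
  refine if_congr ⟨fun hd => ?_, fun hd => ?_⟩ rfl rfl
  · exact (Finsupp.degree_eq_zero_iff d).1 (by exact_mod_cast hd.1)
  · simp [hd]

/-- Over all ways to split off a squarefree monomial, the signs cancel. -/
theorem sum_antidiagonal_squarefree (d : ℕ →₀ ℕ) (hd : d ≠ 0) [DecidablePred fun u : ℕ →₀ ℕ =>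
    ∀ i, u i ≤ 1] :
    ∑ p ∈ Finset.HasAntidiagonal.antidiagonal d with ∀ i, p.1 i ≤ 1, (-1 : ℚ) ^ p.1.degree = 0 := by
  -- Squarefree divisors of the monomial correspond to subsets of its nonempty support.
  have h1 : (∑ s ∈ d.support.powerset, (-1 : ℚ) ^ s.card) = 0 := by
    have := Finset.sum_powerset_neg_one_pow_card_of_nonempty (Finsupp.support_nonempty_iff.2 hd)
    exact_mod_cast congrArg (Int.cast : ℤ → ℚ) this
  rw [← h1]
  have hind : ∀ (s : Finset ℕ) (i : ℕ),
      Finsupp.indicator s (fun _ _ => (1 : ℕ)) i = if i ∈ s then 1 else 0 := by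
    intro s i; simp [Finsupp.indicator_apply]
  refine Finset.sum_bij' (fun p _ => p.1.support)
    (fun s _ => (Finsupp.indicator s (fun _ _ => 1), d - Finsupp.indicator s (fun _ _ => 1)))
    ?_ ?_ ?_ ?_ ?_
  · intro p hp
    simp only [Finset.mem_filter, Finset.HasAntidiagonal.mem_antidiagonal] at hp
    rw [Finset.mem_powerset]
    intro i hi
    have := DFunLike.congr_fun hp.1 i
    simp only [Finsupp.coe_add, Pi.add_apply, Finsupp.mem_support_iff] at this hi ⊢
    omega
  · intro s hs
    rw [Finset.mem_powerset] at hs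
    simp only [Finset.mem_filter, Finset.HasAntidiagonal.mem_antidiagonal]
    refine ⟨?_, fun i => ?_⟩
    · ext i
      simp only [Finsupp.coe_add, Finsupp.coe_tsub, Pi.add_apply, Pi.sub_apply, hind]
      split_ifs with hi
      · have := Finsupp.mem_support_iff.1 (hs hi)
        omega
      · omega
    · rw [hind]; split_ifs <;> omega
  · intro p hp
    simp only [Finset.mem_filter, Finset.HasAntidiagonal.mem_antidiagonal] at hp
    have h2 : Finsupp.indicator p.1.support (fun _ _ => (1 : ℕ)) = p.1 := by
      ext i
      have := hp.2 i
      rw [hind]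
      split_ifs with hi
      · have := Finsupp.mem_support_iff.1 hi; omega
      · exact (Finsupp.notMem_support_iff.1 hi).symm
    ext1
    · exact h2
    · simp only [h2]
      rw [← hp.1, add_tsub_cancel_left]
  · intro s _
    ext i
    rw [Finsupp.mem_support_iff, hind]
    simp
  · intro p hp
    simp only [Finset.mem_filter, Finset.HasAntidiagonal.mem_antidiagonal] at hp
    congr 1
    rw [Finsupp.degree_apply, Finset.card_eq_sum_ones]
    refine Finset.sum_congr rfl fun i hi => ?_
    have := hp.2 i
    have := Finsupp.mem_support_iff.1 hi
    omega

/-- The coefficient form of `E(-t) H(t) = 1`, checked on each monomial. -/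
theorem sum_e_mul_h (n : ℕ) (hn : n ≠ 0) :
    ∑ i ∈ Finset.range (n + 1), (-1) ^ i * (e i * h (n - i)) = 0 := by
  classical
  apply Subtype.ext
  ext d
  have hcoe : ((∑ i ∈ Finset.range (n + 1), (-1) ^ i * (e i * h (n - i)) : Lam) :
      MvPowerSeries ℕ ℚ) =
      ∑ i ∈ Finset.range (n + 1), ((-1) ^ i : ℚ) • (eSeries i * hSeries (n - i)) := by
    push_cast
    refine Finset.sum_congr rfl fun i _ => ?_
    rcases Nat.even_or_odd i with hi | hi
    · rw [hi.neg_one_pow, hi.neg_one_pow, one_mul, one_smul]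
      rfl
    · rw [hi.neg_one_pow, hi.neg_one_pow, neg_one_mul, neg_one_smul]
      rfl
  rw [hcoe, map_sum]
  simp only [map_smul, MvPowerSeries.coeff_mul, coeff_eSeries, coeff_hSeries, smul_eq_mul,
    Finset.mul_sum]
  rw [Finset.sum_comm]
  have hterm : ∀ p ∈ Finset.HasAntidiagonal.antidiagonal d,
      ∑ i ∈ Finset.range (n + 1), (-1 : ℚ) ^ i *
        ((if ((p.1.degree : ℕ) : ℤ) = i ∧ ∀ j, p.1 j ≤ 1 then 1 else 0) *
          if ((p.2.degree : ℕ) : ℤ) = n - i then 1 else 0) =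
      if d.degree = n then (if ∀ j, p.1 j ≤ 1 then (-1) ^ p.1.degree else 0) else 0 := by
    intro p hp
    have hdeg : p.1.degree + p.2.degree = d.degree := by
      rw [← Finset.HasAntidiagonal.mem_antidiagonal.1 hp, map_add]
    split_ifs with h1 h2
    · rw [Finset.sum_eq_single p.1.degree]
      · rw [if_pos ⟨rfl, h2⟩, if_pos (by omega)]; ring
      · intro i _ hi
        rw [if_neg (by omega)]; ring
      · intro hi
        simp at hi; omega
    · refine Finset.sum_eq_zero fun i _ => ?_
      rw [if_neg (fun hh => h2 hh.2)]; ring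
    · refine Finset.sum_eq_zero fun i _ => ?_
      by_cases hi : ((p.1.degree : ℕ) : ℤ) = i
      · rw [if_neg (show ¬ ((p.2.degree : ℕ) : ℤ) = n - i by omega)]; ring
      · rw [if_neg (fun hh => hi hh.1)]; ring
  rw [Finset.sum_congr rfl hterm]
  by_cases h1 : d.degree = n
  · simp only [if_pos h1]
    have hd : d ≠ 0 := by
      rintro rfl
      exact hn (by simpa using h1.symm)
    rw [← Finset.sum_filter]
    refine Eq.trans ?_ (show (0 : ℚ) = _ from rfl)
    convert sum_antidiagonal_squarefree d hd
  · simp only [if_neg h1, Finset.sum_const_zero]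
    rfl

theorem sum_neg_one_pow_mul_reflect {R : Type*} [CommRing R] (f g : ℤ → R) (n : ℕ) :
    ∑ i ∈ Finset.range (n + 1), (-1) ^ i * (f i * g (n - i)) =
      (-1) ^ n * ∑ i ∈ Finset.range (n + 1), (-1) ^ i * (g i * f (n - i)) := by
  rw [← Finset.sum_range_reflect, Finset.mul_sum]
  refine Finset.sum_congr rfl fun i hi => ?_
  have hi' : i ≤ n := Nat.lt_succ_iff.1 (Finset.mem_range.1 hi)
  obtain ⟨l, rfl⟩ := Nat.exists_eq_add_of_le hi'
  have e1 : i + l + 1 - 1 - i = l := by omega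
  have e2 : ((i + l : ℕ) : ℤ) - i = l := by omega
  have e3 : ((i + l : ℕ) : ℤ) - l = i := by omega
  have e4 : ((-1 : R) ^ i) * (-1) ^ i = 1 := by rw [← mul_pow]; simp
  rw [e1, e2, e3, pow_add]
  linear_combination (-(-1) ^ l * (g i * f l)) * e4

theorem sum_h_mul_e (n : ℕ) (hn : n ≠ 0) :
    ∑ i ∈ Finset.range (n + 1), (-1) ^ i * (h i * e (n - i)) = 0 :=
  (sum_neg_one_pow_mul_reflect h e n).trans (by
    rw [sum_e_mul_h n hn]
    exact mul_zero _)

/-- The sums telescope; where the truncations disagree, the extra terms have negative index. -/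
theorem check_sub_check {f : ℤ → Lam} (hf : ∀ n < 0, f n = 0) (n : ℤ) :
    check f n - check f (n - 2) = f n := by
  rw [check, check, Finset.sum_range_succ']
  have hsub : ∑ r ∈ Finset.range n.toNat, f (n - 2 * ((r + 1 : ℕ) : ℤ)) =
      ∑ r ∈ Finset.range ((n - 2).toNat + 1), f (n - 2 - 2 * (r : ℤ)) := by
    have h1 : ∀ r : ℕ, f (n - 2 * ((r + 1 : ℕ) : ℤ)) = f (n - 2 - 2 * (r : ℤ)) := fun r => by
      push_cast; ring_nf
    simp only [h1]
    rcases le_total n.toNat ((n - 2).toNat + 1) with h2 | h2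
    · refine Finset.sum_subset (Finset.range_subset_range.2 h2) fun r _ hr => hf _ ?_
      have := Finset.mem_range.not.1 hr
      omega
    · symm
      refine Finset.sum_subset (Finset.range_subset_range.2 h2) fun r _ hr => hf _ ?_
      have := Finset.mem_range.not.1 hr
      omega
  rw [hsub]
  simp

theorem detPlus_eq_det (f : ℤ → Lam) (a : ℕ → ℕ) (k : ℕ) :
    detPlus f a k = (plusMatrix f a k).det := rfl

theorem detMinus_eq_det (f : ℤ → Lam) (a : ℕ → ℕ) (k : ℕ) :
    detMinus f a k = (minusMatrix f a k).det := rfl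

theorem half_smul_two_mul (x : Lam) : (1 / 2 : ℚ) • (2 * x) = x := by
  rw [two_mul, ← two_smul ℚ x, smul_smul]
  norm_num

theorem half_detPlus_hat (f : ℤ → Lam) (a : ℕ → ℕ) {k : ℕ} (hk : 1 ≤ k) :
    (1 / 2 : ℚ) • detPlus (hat f) a k = detMinus f a k := by
  rw [detPlus_eq_det, detMinus_eq_det, ← half_smul_two_mul (minusMatrix f a k).det,
    ← det_plusMatrix_sub f a hk]
  rfl

theorem detMinus_check {f : ℤ → Lam} (hf : ∀ n < 0, f n = 0) (a : ℕ → ℕ) {k : ℕ} (hk : 1 ≤ k) :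
    detMinus (check f) a k = (1 / 2 : ℚ) • detPlus f a k := by
  rw [← half_detPlus_hat _ _ hk]
  congr 2
  exact funext (check_sub_check hf)

/-- The sizes `k` and `m` vary independently, so this also shows that neither side changes when
zeros are appended. -/
theorem half_detPlus_h (μ : YoungDiagram) {k m : ℕ} (hk1 : 1 ≤ k) (hk : μ.colLen 0 ≤ k)
    (hm : μ.rowLen 0 ≤ m) :
    (1 / 2 : ℚ) • detPlus h μ.rowLen k = detMinus e μ.colLen m := by
  rw [detPlus_eq_det, det_plusMatrix_rowLen h_of_neg e_of_neg h_zero e_zero sum_h_mul_e μ hk1 hk hm,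
    half_smul_two_mul, detMinus_eq_det]

/-- The same duality for the conjugate partition with `h` and `e` exchanged. Here `k = 0` is
allowed, as the definition of `o` needs for the empty partition. -/
theorem half_detPlus_e (μ : YoungDiagram) {k m : ℕ} (hm1 : 1 ≤ m) (hk : μ.colLen 0 ≤ k)
    (hm : μ.rowLen 0 ≤ m) :
    (1 / 2 : ℚ) • detPlus e μ.colLen m = detMinus h μ.rowLen k := by
  have h1 := det_plusMatrix_rowLen e_of_neg h_of_neg e_zero h_zero sum_e_mul_h μ.transpose hm1
    (by rwa [YoungDiagram.colLen_transpose]) (m := k) (by rwa [YoungDiagram.rowLen_transpose])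
  rw [funext μ.rowLen_transpose, funext μ.colLen_transpose] at h1
  rw [detPlus_eq_det, h1, half_smul_two_mul, detMinus_eq_det]

end SymmetricFunctions

end SymFun

theorem theoremT (μ : YoungDiagram) (k m : ℕ) (hk : 1 ≤ k) (hm : 1 ≤ m)
    (hμk : μ.colLen 0 ≤ k) (hμm : μ.rowLen 0 ≤ m) :
    (SymFun.sp μ = (1 / 2 : ℚ) • SymFun.detPlus SymFun.h μ.rowLen k ∧
      SymFun.sp μ = SymFun.detMinus (SymFun.check SymFun.h) μ.rowLen k ∧
      SymFun.sp μ = SymFun.detMinus SymFun.e μ.colLen m ∧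
      SymFun.sp μ = (1 / 2 : ℚ) • SymFun.detPlus (SymFun.hat SymFun.e) μ.colLen m) ∧
    (SymFun.o μ = SymFun.detMinus SymFun.h μ.rowLen k ∧
      SymFun.o μ = (1 / 2 : ℚ) • SymFun.detPlus (SymFun.hat SymFun.h) μ.rowLen k ∧
      SymFun.o μ = (1 / 2 : ℚ) • SymFun.detPlus SymFun.e μ.colLen m ∧
      SymFun.o μ = SymFun.detMinus (SymFun.check SymFun.e) μ.colLen m) := by
  -- The determinant in `e` serves as the common value: it does not involve the number of rows used
  -- to define `sp`, so any admissible `k` can be brought in afterwards.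
  have hsp : SymFun.sp μ = SymFun.detMinus SymFun.e μ.colLen m :=
    SymFun.half_detPlus_h μ (le_max_left _ _) (le_max_right _ _) hμm
  have ho : SymFun.o μ = (1 / 2 : ℚ) • SymFun.detPlus SymFun.e μ.colLen m :=
    (SymFun.half_detPlus_e μ hm le_rfl hμm).symm
  refine ⟨⟨?_, ?_, hsp, ?_⟩, ?_, ?_, ho, ?_⟩
  · rw [hsp, SymFun.half_detPlus_h μ hk hμk hμm]
  · rw [hsp, SymFun.detMinus_check SymFun.h_of_neg _ hk, SymFun.half_detPlus_h μ hk hμk hμm]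
  · rw [hsp, SymFun.half_detPlus_hat _ _ hm]
  · rw [ho, SymFun.half_detPlus_e μ hm hμk hμm]
  · rw [ho, SymFun.half_detPlus_hat _ _ hk, SymFun.half_detPlus_e μ hm hμk hμm]
  · rw [ho, SymFun.detMinus_check SymFun.e_of_neg _ hm]
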